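/- Let $-\infty<a<b<\infty$, $0<\alpha<1$, $0\le\beta\le1$ and $\gamma=\alpha+\beta-\alpha\beta$. **Notation.** For $\sigma>0$ and $x>a$ let $I_{a^+}^{\sigma}y(x)=\frac1{\Gamma(\sigma)}\int_a^x\frac{y(t)\,dt}{(x-t)^{1-\sigma}}$ be the Riemann–Liouville fractional integral, and let $I_{a^+}^{0}y=y$. For $y\in L^1(a,b)$ the Hilfer derivative of order $\alpha$ and type $\beta$ is $$D_{a^+}^{\alpha,\beta}y=I_{a^+}^{\beta(1-\alpha)}\,\frac{d}{dx}\,I_{a^+}^{(1-\beta)(1-\alpha)}y .$$ It is said to exist on $(a,b]$ if $w=I_{a^+}^{(1-\beta)(1-\alpha)}y$ is absolutely continuous on every $[c,b]$, $a<c<b$, and for every $x\in(a,b]$ the Lebesgue integral defining $I_{a^+}^{\beta(1-\alpha)}w'(x)$ converges (if $\beta=0$: $w'(x)$ exists for every $x\in(a,b]$, one-sided at $b$). For $0\le\mu<1$, $C_{\mu}[a,b]$ is the set of functions $y:(a,b]\to\mathbb R$ such that $(x-a)^{\mu}y(x)$ extends to a continuous function on $[a,b]$, and $C_{1-\gamma}^{\alpha,\beta}[a,b]$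 is the set of $y\in C_{1-\gamma}[a,b]$ for which $D_{a^+}^{\alpha,\beta}y$ exists on $(a,b]$ and belongs to $C_{1-\gamma}[a,b]$. **Theorem 4.2.** Let $f:(a,b]\times\mathbb R\to\mathbb R$ be such that $x\mapsto f(x,y(x))$ belongs to $C_{1-\gamma}[a,b]$ for every $y\in C_{1-\gamma}[a,b]$, and suppose that for some $A>0$ $$|f(x,y_1)-f(x,y_2)|\le A|y_1-y_2|\qquad\text{for all }x\in(a,b],\ y_1,y_2\in\mathbb R .$$ Let $y_a,\epsilon\in\mathbb R$, and let $y,\hat y\in C_{1-\gamma}^{\alpha,\beta}[a,b]$ satisfy $$D_{a^+}^{\alpha,\beta}y(x)=f(x,y(x))\ \ (a<x\le b),\qquad \lim_{x\to a^+}I_{a^+}^{1-\gamma}y(x)=y_a,$$ $$D_{a^+}^{\alpha,\beta}\hat y(x)=f(x,\hat y(x))\ \ (a<x\le b),\qquad \lim_{x\to a^+}I_{a^+}^{1-\gamma}\hat y(x)=y_a+\epsilon .$$ Then $$|y(x)-\hat y(x)|\le|\epsilon|\,(x-a)^{\gamma-1}E_{\alpha,\gamma}\big(A(x-a)^{\alpha}\big)\qquad\text{for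 all }x\in(a,b],$$ where $E_{\alpha,\gamma}(z)=\sum_{k=0}^{\infty}\frac{z^k}{\Gamma(k\alpha+\gamma)}$ is the two-parameter Mittag-Leffler function. -/

import Mathlib

open Set MeasureTheory Filter Topology

noncomputable section

/-- The weighted space `C_μ[a,b]`: functions `y` on `(a,b]` such that `(x - a)^μ * y x` is (the
restriction to `(a,b]` of) a continuous function on `[a,b]`. Functions on `(a,b]` are represented
by functions on `ℝ` of which only the values on `(a,b]` matter. -/
def MemWeightedC (a b μ : ℝ) (y : ℝ → ℝ) : Prop :=
  ∃ g : ℝ → ℝ, ContinuousOn g (Icc a b) ∧ ∀ x ∈ Ioc a b, g x = (x - a) ^ μ * y x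

/-- The Riemann–Liouville fractional integral `I_{a+}^σ y (x)` for `σ ≥ 0`, `x > a`, with the
usual convention that `I_{a+}^0` is the identity. -/
def fracIntegral (a σ : ℝ) (y : ℝ → ℝ) (x : ℝ) : ℝ :=
  if σ = 0 then y x
  else 1 / Real.Gamma σ * ∫ t in a..x, y t / (x - t) ^ (1 - σ)

/-- The derivative `D I_{a+}^{(1-β)(1-α)} y` on `(a,b]` (one-sided at `b`). -/
def innerDeriv (a b α β : ℝ) (y : ℝ → ℝ) (x : ℝ) : ℝ :=
  derivWithin (fracIntegral a ((1 - β) * (1 - α)) y) (Ioc a b) x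

/-- The Hilfer derivative of order `0 < α < 1` and type `0 ≤ β ≤ 1` on `(a,b]`,
`D_{a+}^{α,β} y = I_{a+}^{β(1-α)} D I_{a+}^{(1-β)(1-α)} y`. It is meaningful for functions that
satisfy `HilferDifferentiable`. -/
def hilferDeriv (a b α β : ℝ) (y : ℝ → ℝ) (x : ℝ) : ℝ :=
  fracIntegral a (β * (1 - α)) (innerDeriv a b α β y) x

/-- The Hilfer derivative of `y ∈ L¹(a,b)` exists at every point of `(a,b]`: the inner fractional
integral `w = I_{a+}^{(1-β)(1-α)} y` is locally absolutely continuous on `(a,b]`, and the outer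
fractional integral of `w'` exists (as a Lebesgue integral) at each `x ∈ (a,b]`; if the outer
operator is the identity, the latter means that `w' x` itself exists. -/
structure HilferDifferentiable (a b α β : ℝ) (y : ℝ → ℝ) : Prop where
  integrable : IntegrableOn y (Ioc a b)
  absCont : ∀ c ∈ Ioo a b,
    AbsolutelyContinuousOnInterval (fracIntegral a ((1 - β) * (1 - α)) y) c b
  outer_of_eq_zero : β * (1 - α) = 0 → ∀ x ∈ Ioc a b,
    DifferentiableWithinAt ℝ (fracIntegral a ((1 - β) * (1 - α)) y) (Ioc a b) x
  outer_of_ne_zero : β * (1 - α) ≠ 0 → ∀ x ∈ Ioc a b,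
    IntervalIntegrable (fun t => innerDeriv a b α β y t / (x - t) ^ (1 - β * (1 - α))) volume a x

/-- The space `C_{1-γ}^{α,β}[a,b]`, `γ = α + β(1-α)`: functions in `C_{1-γ}[a,b]` whose Hilfer
derivative exists and lies in `C_{1-γ}[a,b]`. -/
def MemHilferSpace (a b α β : ℝ) (y : ℝ → ℝ) : Prop :=
  MemWeightedC a b (1 - (α + β * (1 - α))) y ∧
  HilferDifferentiable a b α β y ∧
  MemWeightedC a b (1 - (α + β * (1 - α))) (hilferDeriv a b α β y)

/-- `y ∈ C_{1-γ}^{α,β}[a,b]` solves the Cauchy-type problem `D_{a+}^{α,β} y (x) = f (x, y x)` on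
`(a,b]`, `I_{a+}^{1-γ} y (a) = ya`, where `γ = α + β(1-α)` and the value at `a` is the limit
from the right. -/
structure IsCauchySolution (a b α β : ℝ) (f : ℝ → ℝ → ℝ) (ya : ℝ) (y : ℝ → ℝ) : Prop where
  mem : MemHilferSpace a b α β y
  equation : ∀ x ∈ Ioc a b, hilferDeriv a b α β y x = f x (y x)
  initial : Tendsto (fracIntegral a (1 - (α + β * (1 - α))) y) (𝓝[>] a) (𝓝 ya)

/-- The two-parameter Mittag-Leffler function
`E_{α,γ}(z) = ∑_{k ≥ 0} z^k / Γ(k α + γ)` (used for `α, γ > 0`, where the series converges). -/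
def mittagLeffler (α γ z : ℝ) : ℝ :=
  ∑' k : ℕ, z ^ k / Real.Gamma (k * α + γ)

end

/-! Put `κ_s(t) = t₊^(s-1) / Γ(s)`, so that `I_{a+}^s` is convolution with `κ_s` on functions that
vanish left of `a`, and `κ_s * κ_t = κ_{s+t}` by the Beta integral. Applying `I^γ` to
`I^{1-γ} y = ya + I^1 w'` and cancelling one integration turns the Cauchy problem into the Volterra
equation `y = ya κ_γ(· - a) + I^α f(·, y)`. Hence `u = |y - ŷ|` satisfies
`u ≤ |ε| κ_γ(· - a) + A I^α u`; iterating this, the `k`-th step contributes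
`|ε| A^k κ_{kα+γ}(· - a)`, and the sum of these terms is the Mittag-Leffler bound. All of this is
carried out almost everywhere; continuity of both sides gives the inequality at every point. -/

section Kernel

variable {s t : ℝ}

/-- The convolution kernel `t₊^(s-1) / Γ(s)` of the Riemann–Liouville integral of order `s`. It
is `0` at the origin, and vanishes identically for `s = 0` since `Real.Gamma 0 = 0`. -/
noncomputable def rlKernel (s t : ℝ) : ℝ :=
  if 0 < t then t ^ (s - 1) / Real.Gamma s else 0

lemma rlKernel_of_pos (ht : 0 < t) : rlKernel s t = t ^ (s - 1) / Real.Gamma s :=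
  if_pos ht

lemma rlKernel_of_nonpos (ht : t ≤ 0) : rlKernel s t = 0 := if_neg ht.not_gt

lemma rlKernel_zero_left : rlKernel 0 t = 0 := by
  simp [rlKernel]

lemma rlKernel_one_of_pos (ht : 0 < t) : rlKernel 1 t = 1 := by
  simp [rlKernel_of_pos ht]

lemma rlKernel_nonneg (hs : 0 ≤ s) (t : ℝ) : 0 ≤ rlKernel s t := by
  have := Real.Gamma_nonneg_of_nonneg hs
  unfold rlKernel
  split_ifs <;> positivity

@[fun_prop]
lemma measurable_rlKernel (s : ℝ) : Measurable (rlKernel s) :=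
  Measurable.ite measurableSet_Ioi (by fun_prop) (by fun_prop)

lemma betaPDFReal_nonneg (hs : 0 < s) (ht : 0 < t) (u : ℝ) :
    0 ≤ ProbabilityTheory.betaPDFReal s t u := by
  by_cases hu : 0 < u ∧ u < 1
  · exact (ProbabilityTheory.betaPDFReal_pos hu.1 hu.2 hs ht).le
  · simp [ProbabilityTheory.betaPDFReal, hu]

lemma integrable_betaPDFReal (hs : 0 < s) (ht : 0 < t) :
    Integrable (ProbabilityTheory.betaPDFReal s t) := by
  refine ⟨by fun_prop, ?_⟩
  rw [hasFiniteIntegral_iff_ofReal (ae_of_all _ (betaPDFReal_nonneg hs ht))]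
  exact (ProbabilityTheory.lintegral_betaPDF_eq_one hs ht).trans_lt ENNReal.one_lt_top

lemma integral_betaPDFReal (hs : 0 < s) (ht : 0 < t) :
    ∫ u, ProbabilityTheory.betaPDFReal s t u = 1 := by
  rw [integral_eq_lintegral_of_nonneg_ae (ae_of_all _ (betaPDFReal_nonneg hs ht)) (by fun_prop)]
  exact (congrArg ENNReal.toReal (ProbabilityTheory.lintegral_betaPDF_eq_one hs ht)).trans
    ENNReal.toReal_one

lemma rlKernel_mul_rlKernel_of_le {x r : ℝ} (h : x ≤ r) (τ : ℝ) :
    rlKernel s (x - τ) * rlKernel t (τ - r) = 0 := by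
  rcases le_total τ r with hτ | hτ
  · rw [rlKernel_of_nonpos (t := τ - r) (by linarith), mul_zero]
  · rw [rlKernel_of_nonpos (t := x - τ) (by linarith), zero_mul]

lemma rlKernel_mul_rlKernel_of_lt (hs : 0 < s) (ht : 0 < t) {x r : ℝ} (h : r < x) (τ : ℝ) :
    rlKernel s (x - τ) * rlKernel t (τ - r) = (x - r) ^ (s + t - 2) / Real.Gamma (s + t) *
      ProbabilityTheory.betaPDFReal t s ((τ - r) / (x - r)) := by
  have hd : 0 < x - r := sub_pos.2 h
  by_cases hτ : r < τ ∧ τ < x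
  · have hl : 0 < τ - r := sub_pos.2 hτ.1
    have hr : 0 < x - τ := sub_pos.2 hτ.2
    have hu : 1 - (τ - r) / (x - r) = (x - τ) / (x - r) := by field_simp; ring
    have hΓ := (Real.Gamma_pos_of_pos (add_pos hs ht)).ne'
    rw [ProbabilityTheory.betaPDFReal, if_pos ⟨div_pos hl hd, (div_lt_one hd).2 (by linarith)⟩,
      hu, Real.div_rpow hl.le hd.le, Real.div_rpow hr.le hd.le, rlKernel_of_pos hr,
      rlKernel_of_pos hl, ProbabilityTheory.beta, add_comm t s,
      show s + t - 2 = (s - 1) + (t - 1) by ring, Real.rpow_add hd]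
    field_simp
  · rw [ProbabilityTheory.betaPDFReal, if_neg, mul_zero]
    · rcases not_and_or.1 hτ with hτ | hτ
      · rw [rlKernel_of_nonpos (t := τ - r) (by linarith), mul_zero]
      · rw [rlKernel_of_nonpos (t := x - τ) (by linarith), zero_mul]
    · rwa [div_pos_iff_of_pos_right hd, div_lt_one hd, sub_pos, sub_lt_sub_iff_right]

lemma integrable_rlKernel_mul_rlKernel (hs : 0 < s) (ht : 0 < t) (x r : ℝ) :
    Integrable (fun τ => rlKernel s (x - τ) * rlKernel t (τ - r)) := by
  rcases le_or_gt x r with h | h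
  · simp only [rlKernel_mul_rlKernel_of_le h]
    exact integrable_zero _ _ _
  · simp only [rlKernel_mul_rlKernel_of_lt hs ht h]
    exact (((integrable_betaPDFReal ht hs).comp_div (sub_pos.2 h).ne').comp_sub_right r).const_mul _

lemma integral_rlKernel_mul_rlKernel (hs : 0 < s) (ht : 0 < t) (x r : ℝ) :
    ∫ τ, rlKernel s (x - τ) * rlKernel t (τ - r) = rlKernel (s + t) (x - r) := by
  rcases le_or_gt x r with h | h
  · simp only [rlKernel_mul_rlKernel_of_le h, integral_zero, rlKernel_of_nonpos (sub_nonpos.2 h)]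
  · have hd : 0 < x - r := sub_pos.2 h
    simp only [rlKernel_mul_rlKernel_of_lt hs ht h]
    rw [integral_const_mul,
      integral_sub_right_eq_self (fun v => ProbabilityTheory.betaPDFReal t s (v / (x - r))) r,
      Measure.integral_comp_div, integral_betaPDFReal ht hs, abs_of_pos hd, rlKernel_of_pos hd,
      show s + t - 1 = (s + t - 2) + 1 by ring, Real.rpow_add_one hd.ne', smul_eq_mul]
    ring

end Kernel

section Integral

variable {s t x : ℝ} {g h : ℝ → ℝ}

/-- The Riemann–Liouville integral of order `s > 0` over the whole line, extended by the identity
to `s = 0`. On functions supported in `(a, ∞)` it is `I_{a+}^s`. -/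
noncomputable def rlInt (s : ℝ) (h : ℝ → ℝ) (x : ℝ) : ℝ :=
  if s = 0 then h x else ∫ τ, rlKernel s (x - τ) * h τ

/-- Convergence of the Lebesgue integral defining `rlInt s h x`; void for `s = 0`, where the kernel
vanishes. -/
def RLIntegrableAt (s : ℝ) (h : ℝ → ℝ) (x : ℝ) : Prop :=
  Integrable fun τ => rlKernel s (x - τ) * h τ

lemma rlInt_zero (h : ℝ → ℝ) : rlInt 0 h = h := by
  funext x; simp [rlInt]

lemma rlInt_of_pos (hs : 0 < s) (h : ℝ → ℝ) (x : ℝ) :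
    rlInt s h x = ∫ τ, rlKernel s (x - τ) * h τ := if_neg hs.ne'

lemma rlIntegrableAt_zero : RLIntegrableAt 0 h x := by
  simp [RLIntegrableAt, rlKernel_zero_left]

lemma RLIntegrableAt.add (hg : RLIntegrableAt s g x) (hh : RLIntegrableAt s h x) :
    RLIntegrableAt s (fun τ => g τ + h τ) x := by
  simp only [RLIntegrableAt, mul_add]
  exact Integrable.add hg hh

lemma RLIntegrableAt.const_mul (c : ℝ) (hh : RLIntegrableAt s h x) :
    RLIntegrableAt s (fun τ => c * h τ) x := by
  simpa only [RLIntegrableAt, mul_left_comm _ c] using Integrable.const_mul hh c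

lemma RLIntegrableAt.sum {ι : Type*} (S : Finset ι) {g : ι → ℝ → ℝ}
    (hg : ∀ i ∈ S, RLIntegrableAt s (g i) x) :
    RLIntegrableAt s (fun τ => ∑ i ∈ S, g i τ) x := by
  simpa only [RLIntegrableAt, Finset.mul_sum] using integrable_finsetSum S hg

lemma rlInt_add (hs : 0 < s) (hg : RLIntegrableAt s g x) (hh : RLIntegrableAt s h x) :
    rlInt s (fun τ => g τ + h τ) x = rlInt s g x + rlInt s h x := by
  simp only [rlInt_of_pos hs, mul_add]
  exact integral_add hg hh

lemma rlInt_sub (hs : 0 < s) (hg : RLIntegrableAt s g x) (hh : RLIntegrableAt s h x) :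
    rlInt s (fun τ => g τ - h τ) x = rlInt s g x - rlInt s h x := by
  simp only [rlInt_of_pos hs, mul_sub]
  exact integral_sub hg hh

lemma rlInt_const_mul (hs : 0 < s) (c : ℝ) (h : ℝ → ℝ) (x : ℝ) :
    rlInt s (fun τ => c * h τ) x = c * rlInt s h x := by
  simp only [rlInt_of_pos hs, mul_left_comm _ c, integral_const_mul]

lemma rlInt_sum (hs : 0 < s) {ι : Type*} (S : Finset ι) {g : ι → ℝ → ℝ}
    (hg : ∀ i ∈ S, RLIntegrableAt s (g i) x) :
    rlInt s (fun τ => ∑ i ∈ S, g i τ) x = ∑ i ∈ S, rlInt s (g i) x := by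
  simp only [rlInt_of_pos hs, Finset.mul_sum]
  exact integral_finsetSum S hg

lemma rlInt_congr (hgh : ∀ τ ≤ x, g τ = h τ) : rlInt s g x = rlInt s h x := by
  unfold rlInt
  split_ifs
  · exact hgh x le_rfl
  · congr 1
    funext τ
    rcases le_total τ x with hτ | hτ
    · rw [hgh τ hτ]
    · rw [rlKernel_of_nonpos (sub_nonpos.2 hτ), zero_mul, zero_mul]

lemma rlInt_nonneg (hs : 0 < s) (hh : 0 ≤ h) : 0 ≤ rlInt s h x := by
  rw [rlInt_of_pos hs]
  exact integral_nonneg fun τ => mul_nonneg (rlKernel_nonneg hs.le _) (hh τ)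

lemma rlInt_mono_ae (hs : 0 < s) (hg : 0 ≤ g) (hh : RLIntegrableAt s h x)
    (hgh : ∀ᵐ τ, g τ ≤ h τ) : rlInt s g x ≤ rlInt s h x := by
  rw [rlInt_of_pos hs, rlInt_of_pos hs]
  refine integral_mono_of_nonneg
    (ae_of_all _ fun τ => mul_nonneg (rlKernel_nonneg hs.le _) (hg τ)) hh ?_
  filter_upwards [hgh] with τ hτ using mul_le_mul_of_nonneg_left hτ (rlKernel_nonneg hs.le _)

lemma abs_rlInt_le (hs : 0 < s) (hh : RLIntegrableAt s h x) (hgh : ∀ τ, |g τ| ≤ h τ) :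
    |rlInt s g x| ≤ rlInt s h x := by
  rw [rlInt_of_pos hs, rlInt_of_pos hs, ← Real.norm_eq_abs]
  refine norm_integral_le_of_norm_le hh (ae_of_all _ fun τ => ?_)
  rw [norm_mul, Real.norm_of_nonneg (rlKernel_nonneg hs.le _)]
  exact mul_le_mul_of_nonneg_left (hgh τ) (rlKernel_nonneg hs.le _)

lemma rlIntegrableAt_rlKernel (hs : 0 < s) (ht : 0 < t) (a x : ℝ) :
    RLIntegrableAt s (fun τ => rlKernel t (τ - a)) x :=
  integrable_rlKernel_mul_rlKernel hs ht x a

lemma rlInt_rlKernel (hs : 0 < s) (ht : 0 < t) (a x : ℝ) :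
    rlInt s (fun τ => rlKernel t (τ - a)) x = rlKernel (s + t) (x - a) := by
  rw [rlInt_of_pos hs, integral_rlKernel_mul_rlKernel hs ht]

end Integral

section Semigroup

variable {s t x b c : ℝ} {g h : ℝ → ℝ}

lemma integrable_rlKernel_prod (hs : 0 < s) (ht : 0 < t) (hm : AEStronglyMeasurable h)
    (hi : RLIntegrableAt (s + t) h x) :
    Integrable (fun p : ℝ × ℝ => rlKernel s (x - p.1) * (rlKernel t (p.1 - p.2) * h p.2))
      (volume.prod volume) := by
  have hmeas : AEStronglyMeasurable
      (fun p : ℝ × ℝ => rlKernel s (x - p.1) * (rlKernel t (p.1 - p.2) * h p.2))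
      (volume.prod volume) := by
    have h1 : Measurable fun p : ℝ × ℝ => rlKernel s (x - p.1) := by fun_prop
    have h2 : Measurable fun p : ℝ × ℝ => rlKernel t (p.1 - p.2) := by fun_prop
    exact h1.aestronglyMeasurable.mul (h2.aestronglyMeasurable.mul hm.comp_snd)
  rw [integrable_prod_iff' hmeas]
  constructor
  · refine ae_of_all _ fun r => ?_
    simpa only [mul_assoc] using (integrable_rlKernel_mul_rlKernel hs ht x r).mul_const (h r)
  · refine (Integrable.norm hi).congr (ae_of_all _ fun r => ?_)
    have hnorm (τ : ℝ) : ‖rlKernel s (x - τ) * (rlKernel t (τ - r) * h r)‖ =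
        rlKernel s (x - τ) * rlKernel t (τ - r) * ‖h r‖ := by
      rw [norm_mul, norm_mul, Real.norm_of_nonneg (rlKernel_nonneg hs.le _),
        Real.norm_of_nonneg (rlKernel_nonneg ht.le _), mul_assoc]
    simp only [hnorm]
    rw [integral_mul_const, integral_rlKernel_mul_rlKernel hs ht, norm_mul,
      Real.norm_of_nonneg (rlKernel_nonneg (add_pos hs ht).le _)]

lemma rlIntegrableAt_rlInt (hs : 0 ≤ s) (ht : 0 ≤ t) (hm : AEStronglyMeasurable h)
    (hi : RLIntegrableAt (s + t) h x) : RLIntegrableAt s (rlInt t h) x := by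
  rcases hs.eq_or_lt with rfl | hs
  · exact rlIntegrableAt_zero
  rcases ht.eq_or_lt with rfl | ht
  · simpa only [rlInt_zero, add_zero] using hi
  · simpa only [RLIntegrableAt, integral_const_mul, ← rlInt_of_pos ht] using
      (integrable_rlKernel_prod hs ht hm hi).integral_prod_left

lemma RLIntegrableAt.ae_of_one_add (ht : 0 < t) (hm : AEStronglyMeasurable h)
    (hi : RLIntegrableAt (1 + t) h x) : ∀ᵐ τ, τ < x → RLIntegrableAt t h τ := by
  filter_upwards [(integrable_rlKernel_prod one_pos ht hm hi).prod_right_ae] with τ hτ hτx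
  simpa only [RLIntegrableAt, rlKernel_one_of_pos (sub_pos.2 hτx), one_mul] using hτ

lemma rlInt_rlInt (hs : 0 ≤ s) (ht : 0 ≤ t) (hm : AEStronglyMeasurable h)
    (hi : RLIntegrableAt (s + t) h x) : rlInt s (rlInt t h) x = rlInt (s + t) h x := by
  rcases hs.eq_or_lt with rfl | hs
  · rw [rlInt_zero, zero_add]
  rcases ht.eq_or_lt with rfl | ht
  · rw [rlInt_zero, add_zero]
  have swap := integral_integral_swap
    (f := fun τ r => rlKernel s (x - τ) * (rlKernel t (τ - r) * h r))
    (integrable_rlKernel_prod hs ht hm hi)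
  simp only [integral_const_mul, ← rlInt_of_pos ht] at swap
  rw [rlInt_of_pos hs, swap, rlInt_of_pos (add_pos hs ht)]
  refine integral_congr_ae (ae_of_all _ fun r => ?_)
  simp only [← mul_assoc]
  rw [integral_mul_const, integral_rlKernel_mul_rlKernel hs ht]

lemma rlKernel_one_mul_eq_indicator (h : ℝ → ℝ) (x : ℝ) :
    (fun τ => rlKernel 1 (x - τ) * h τ) = (Iio x).indicator h := by
  funext τ
  by_cases hτ : τ < x
  · rw [rlKernel_one_of_pos (sub_pos.2 hτ), one_mul, indicator_of_mem (mem_Iio.2 hτ)]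
  · rw [rlKernel_of_nonpos (sub_nonpos.2 (not_lt.1 hτ)), zero_mul,
      indicator_of_notMem (notMem_Iio.2 (not_lt.1 hτ))]

lemma rlIntegrableAt_one_iff : RLIntegrableAt 1 h x ↔ IntegrableOn h (Iic x) := by
  rw [RLIntegrableAt, rlKernel_one_mul_eq_indicator, integrable_indicator_iff measurableSet_Iio,
    integrableOn_Iic_iff_integrableOn_Iio]

lemma rlInt_one (h : ℝ → ℝ) (x : ℝ) : rlInt 1 h x = ∫ τ in Iic x, h τ := by
  rw [rlInt_of_pos one_pos, rlKernel_one_mul_eq_indicator, integral_indicator measurableSet_Iio,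
    integral_Iic_eq_integral_Iio]

lemma ae_eq_zero_of_forall_integral_Iic_eq_zero (hh : IntegrableOn h (Iic b))
    (h0 : ∀ x ≤ b, ∫ τ in Iic x, h τ = 0) : ∀ᵐ x, x < b → h x = 0 := by
  have hloc := ((integrable_indicator_iff measurableSet_Iic).2 hh).locallyIntegrable
  filter_upwards [_root_.LocallyIntegrable.ae_hasDerivAt_integral hloc] with x hx hxb
  have hderiv := hx x
  rw [indicator_of_mem (mem_Iic.2 hxb.le)] at hderiv
  refine hderiv.unique ((hasDerivAt_const x (0 : ℝ)).congr_of_eventuallyEq ?_)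
  filter_upwards [Iio_mem_nhds hxb] with u (hu : u < b)
  have hcongr : ∫ τ in x..u, (Iic b).indicator h τ = ∫ τ in x..u, h τ :=
    intervalIntegral.integral_congr fun τ hτ =>
      indicator_of_mem (mem_Iic.2 (hτ.2.trans (sup_le hxb.le hu.le))) h
  rw [hcongr, ← intervalIntegral.integral_Iic_sub_Iic (hh.mono_set (Iic_subset_Iic.2 hxb.le))
    (hh.mono_set (Iic_subset_Iic.2 hu.le)), h0 x hxb.le, h0 u hu.le, sub_zero]

lemma ae_eq_of_rlInt_one_eq (hg : RLIntegrableAt 1 g b) (hh : RLIntegrableAt 1 h b)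
    (hgh : ∀ x ≤ b, rlInt 1 g x = rlInt 1 h x) : ∀ᵐ x, x < b → g x = h x := by
  rw [rlIntegrableAt_one_iff] at hg hh
  have hzero := ae_eq_zero_of_forall_integral_Iic_eq_zero (Integrable.sub hg hh) fun x hx => by
    have hx' := hgh x hx
    rw [rlInt_one, rlInt_one] at hx'
    have hsub := Iic_subset_Iic.2 hx
    simp only [Pi.sub_apply]
    rw [integral_sub (hg.mono_set hsub) (hh.mono_set hsub), hx', sub_self]
  filter_upwards [hzero] with x hx hxb using sub_eq_zero.1 (hx hxb)

lemma ae_eq_of_rlInt_eq (a : ℝ) (hs : 0 ≤ s) (ht : 0 < t) (hst : t + s = 1)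
    (hgm : AEStronglyMeasurable g) (hg : ∀ x ≤ b, RLIntegrableAt 1 g x)
    (hhm : AEStronglyMeasurable h) (hh : ∀ x ≤ b, RLIntegrableAt (1 + t) h x)
    (hgh : ∀ x ≤ b, rlInt s g x = c * rlKernel 1 (x - a) + rlInt 1 h x) :
    ∀ᵐ x, x < b → g x = c * rlKernel t (x - a) + rlInt t h x := by
  have hK (x : ℝ) := (rlIntegrableAt_rlKernel one_pos ht a x).const_mul c
  have hI (x : ℝ) (hx : x ≤ b) := rlIntegrableAt_rlInt zero_le_one ht.le hhm (hh x hx)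
  refine ae_eq_of_rlInt_one_eq (hg b le_rfl) ((hK b).add (hI b le_rfl)) fun x hx => ?_
  have hh' : RLIntegrableAt (t + 1) h x := add_comm 1 t ▸ hh x hx
  calc rlInt 1 g x = rlInt t (rlInt s g) x := by
        rw [rlInt_rlInt ht.le hs hgm (hst.symm ▸ hg x hx), hst]
    _ = rlInt t (fun τ => c * rlKernel 1 (τ - a) + rlInt 1 h τ) x :=
        rlInt_congr fun τ hτ => hgh τ (hτ.trans hx)
    _ = c * rlKernel (t + 1) (x - a) + rlInt (t + 1) h x := by
        rw [rlInt_add ht ((rlIntegrableAt_rlKernel ht one_pos a x).const_mul c)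
            (rlIntegrableAt_rlInt ht.le zero_le_one hhm hh'), rlInt_const_mul ht,
          rlInt_rlKernel ht one_pos, rlInt_rlInt ht.le zero_le_one hhm hh']
    _ = rlInt 1 (fun τ => c * rlKernel t (τ - a) + rlInt t h τ) x := by
        rw [rlInt_add one_pos (hK x) (hI x hx), rlInt_const_mul one_pos, rlInt_rlKernel one_pos ht,
          rlInt_rlInt zero_le_one ht.le hhm (hh x hx), add_comm t 1]

end Semigroup

section MittagLeffler

variable {α γ : ℝ}

lemma rpow_mul_exp_neg_le_Gamma {R s : ℝ} (hR : 0 ≤ R) (hs : 1 ≤ s) :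
    R ^ (s - 1) * Real.exp (-R) ≤ Real.Gamma s := by
  have hs0 : 0 < s := by linarith
  have hi := Real.GammaIntegral_convergent hs0
  rw [Real.Gamma_eq_integral hs0, ← integral_exp_neg_Ioi R, ← integral_const_mul]
  calc ∫ x in Ioi R, R ^ (s - 1) * Real.exp (-x)
      ≤ ∫ x in Ioi R, Real.exp (-x) * x ^ (s - 1) := by
        refine setIntegral_mono_on ((integrableOn_exp_neg_Ioi R).const_mul _)
          (hi.mono_set (Ioi_subset_Ioi hR)) measurableSet_Ioi fun x hx => ?_
        have hRx : R ≤ x := le_of_lt hx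
        rw [mul_comm]
        gcongr
    _ ≤ ∫ x in Ioi 0, Real.exp (-x) * x ^ (s - 1) := by
        refine setIntegral_mono_set hi ?_ (Ioi_subset_Ioi hR).eventuallyLE
        filter_upwards [ae_restrict_mem measurableSet_Ioi] with x (hx : 0 < x)
        exact mul_nonneg (Real.exp_nonneg _) (Real.rpow_nonneg hx.le _)

lemma summable_mittagLeffler (hα : 0 < α) (γ z : ℝ) :
    Summable fun k : ℕ => z ^ k / Real.Gamma (k * α + γ) := by
  -- chosen so that `R ^ α = 2 * |z| + 1`, which makes the comparison series geometric
  set R : ℝ := (2 * |z| + 1) ^ α⁻¹ with hRdef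
  have hR : 0 < R := by positivity
  have hq : |z| / R ^ α < 1 := by
    rw [hRdef, Real.rpow_inv_rpow (by positivity) hα.ne', div_lt_one (by positivity)]
    linarith [abs_nonneg z]
  refine Summable.of_norm_bounded_eventually_nat
    ((summable_geometric_of_lt_one (by positivity) hq).mul_left (Real.exp R * R ^ (1 - γ))) ?_
  have hlarge : ∀ᶠ k : ℕ in atTop, 1 ≤ k * α + γ :=
    (tendsto_atTop_add_const_right _ γ
      (tendsto_natCast_atTop_atTop.atTop_mul_const hα)).eventually_ge_atTop 1
  filter_upwards [hlarge] with k hk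
  have hΓ := Real.Gamma_pos_of_pos (one_pos.trans_le hk)
  have hpow : R ^ (k * α + γ - 1) = (R ^ α) ^ k / R ^ (1 - γ) := by
    rw [← Real.rpow_natCast, ← Real.rpow_mul hR.le, ← Real.rpow_sub hR]
    ring_nf
  rw [norm_div, norm_pow, Real.norm_of_nonneg hΓ.le, Real.norm_eq_abs]
  calc |z| ^ k / Real.Gamma (k * α + γ)
      ≤ |z| ^ k / (R ^ (k * α + γ - 1) * Real.exp (-R)) := by
        gcongr
        exact rpow_mul_exp_neg_le_Gamma hR.le hk
    _ = Real.exp R * R ^ (1 - γ) * (|z| / R ^ α) ^ k := by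
        rw [hpow, Real.exp_neg, div_pow]
        field_simp

lemma continuous_mittagLeffler (hα : 0 < α) (γ : ℝ) : Continuous (mittagLeffler α γ) := by
  refine continuous_iff_continuousAt.2 fun z => ?_
  have hcont : ContinuousOn (mittagLeffler α γ) (Metric.ball 0 (|z| + 1)) := by
    refine continuousOn_tsum (fun k => by fun_prop)
      (summable_mittagLeffler hα γ (|z| + 1)).norm fun k w hw => ?_
    rw [norm_div, norm_div, norm_pow, norm_pow]
    gcongr
    exact (mem_ball_zero_iff.1 hw).le.trans (le_abs_self _)
  exact hcont.continuousAt (Metric.isOpen_ball.mem_nhds (by simp))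

lemma continuousOn_sub_rpow (a b s : ℝ) : ContinuousOn (fun x => (x - a) ^ s) (Ioc a b) :=
  ContinuousOn.rpow_const (by fun_prop) fun _ hx => Or.inl (sub_pos.2 hx.1).ne'

lemma continuousOn_rpow_mul_mittagLeffler (hα : 0 < α) (a b γ e A : ℝ) :
    ContinuousOn (fun x => e * (x - a) ^ (γ - 1) * mittagLeffler α γ (A * (x - a) ^ α))
      (Ioc a b) :=
  (continuousOn_const.mul (continuousOn_sub_rpow a b _)).mul
    ((continuous_mittagLeffler hα _).comp_continuousOn
      (continuousOn_const.mul (continuousOn_sub_rpow a b α)))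

end MittagLeffler

section Gronwall

variable {a α γ A e M : ℝ}

/-- The `n`-th Picard iterate, started from `M * rlKernel γ (· - a)`, of the integral operator
`v ↦ e * rlKernel γ (· - a) + A * rlInt α v`. -/
noncomputable def gronwallIterate (a α γ A e M : ℝ) (n : ℕ) (x : ℝ) : ℝ :=
  ∑ k ∈ Finset.range n, e * A ^ k * rlKernel (k * α + γ) (x - a) +
    M * A ^ n * rlKernel (n * α + γ) (x - a)

lemma rlIntegrableAt_gronwallIterate (hα : 0 < α) (hγ : 0 < γ) (n : ℕ) (x : ℝ) :
    RLIntegrableAt α (gronwallIterate a α γ A e M n) x :=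
  .add (.sum _ fun _ _ => (rlIntegrableAt_rlKernel hα (by positivity) a x).const_mul _)
    ((rlIntegrableAt_rlKernel hα (by positivity) a x).const_mul _)

lemma gronwallIterate_succ (hα : 0 < α) (hγ : 0 < γ) (n : ℕ) (x : ℝ) :
    gronwallIterate a α γ A e M (n + 1) x =
      e * rlKernel γ (x - a) + A * rlInt α (gronwallIterate a α γ A e M n) x := by
  have hK (k : ℕ) (c : ℝ) := (rlIntegrableAt_rlKernel hα
    (by positivity : 0 < k * α + γ) a x).const_mul c
  have hshift (k : ℕ) (c : ℝ) : rlInt α (fun τ => c * rlKernel (k * α + γ) (τ - a)) x =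
      c * rlKernel ((k + 1 : ℕ) * α + γ) (x - a) := by
    rw [rlInt_const_mul hα, rlInt_rlKernel hα (by positivity)]
    push_cast
    ring_nf
  unfold gronwallIterate
  rw [rlInt_add hα (.sum _ fun k _ => hK k _) (hK n _), rlInt_sum hα _ fun k _ => hK k _]
  simp only [hshift]
  rw [Finset.sum_range_succ', mul_add, Finset.mul_sum]
  simp only [pow_succ', Nat.cast_zero, pow_zero, zero_mul, zero_add, mul_one, mul_assoc,
    mul_left_comm _ A]
  ring

lemma pow_mul_rlKernel (α γ A : ℝ) {d : ℝ} (hd : 0 < d) (k : ℕ) :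
    A ^ k * rlKernel (k * α + γ) d =
      d ^ (γ - 1) * ((A * d ^ α) ^ k / Real.Gamma (k * α + γ)) := by
  rw [rlKernel_of_pos hd, add_sub_assoc, Real.rpow_add hd, mul_comm (k : ℝ), Real.rpow_mul hd.le,
    Real.rpow_natCast, mul_pow]
  ring

lemma tendsto_gronwallIterate (hα : 0 < α) {x : ℝ} (hx : a < x) :
    Tendsto (fun n => gronwallIterate a α γ A e M n x) atTop
      (𝓝 (e * (x - a) ^ (γ - 1) * mittagLeffler α γ (A * (x - a) ^ α))) := by
  have hsum := summable_mittagLeffler hα γ (A * (x - a) ^ α)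
  simp only [gronwallIterate, mittagLeffler, mul_assoc, pow_mul_rlKernel α γ A (sub_pos.2 hx),
    ← Finset.mul_sum]
  simpa only [mul_zero, add_zero] using
    ((hsum.hasSum.tendsto_sum_nat.const_mul _).const_mul e).add
      ((hsum.tendsto_atTop_zero.const_mul _).const_mul M)

lemma ae_le_mittagLeffler_of_ae_le_rlInt (hα : 0 < α) (hγ : 0 < γ) (hA : 0 ≤ A) {u : ℝ → ℝ}
    (hu : 0 ≤ u) (huM : ∀ᵐ x, u x ≤ M * rlKernel γ (x - a))
    (hue : ∀ᵐ x, u x ≤ e * rlKernel γ (x - a) + A * rlInt α u x) :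
    ∀ᵐ x, a < x → u x ≤ e * (x - a) ^ (γ - 1) * mittagLeffler α γ (A * (x - a) ^ α) := by
  have hiter (n : ℕ) : ∀ᵐ x, u x ≤ gronwallIterate a α γ A e M n x := by
    induction n with
    | zero => simpa [gronwallIterate] using huM
    | succ n ih =>
      filter_upwards [hue] with x hx
      rw [gronwallIterate_succ hα hγ]
      refine hx.trans ?_
      gcongr
      exact rlInt_mono_ae hα hu (rlIntegrableAt_gronwallIterate hα hγ n x) ih
  filter_upwards [ae_all_iff.2 hiter] with x hx hax
  exact ge_of_tendsto' (tendsto_gronwallIterate hα hax) hx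

end Gronwall

section WeightedSpace

variable {a b γ s μ : ℝ} {y z : ℝ → ℝ}

lemma MemWeightedC.congr (hy : MemWeightedC a b μ y) (h : EqOn y z (Ioc a b)) :
    MemWeightedC a b μ z := by
  obtain ⟨g, hg, hgy⟩ := hy
  exact ⟨g, hg, fun x hx => by rw [hgy x hx, h hx]⟩

lemma MemWeightedC.sub (hy : MemWeightedC a b μ y) (hz : MemWeightedC a b μ z) :
    MemWeightedC a b μ (fun x => y x - z x) := by
  obtain ⟨g, hg, hgy⟩ := hy
  obtain ⟨k, hk, hkz⟩ := hz
  exact ⟨fun x => g x - k x, hg.sub hk, fun x hx => by simp only [hgy x hx, hkz x hx, mul_sub]⟩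

lemma MemWeightedC.abs (hy : MemWeightedC a b μ y) : MemWeightedC a b μ (fun x => |y x|) := by
  obtain ⟨g, hg, hgy⟩ := hy
  refine ⟨fun x => |g x|, hg.abs, fun x hx => ?_⟩
  simp only [hgy x hx, abs_mul, abs_of_nonneg (Real.rpow_nonneg (sub_nonneg.2 hx.1.le) μ)]

lemma MemWeightedC.exists_eq (hy : MemWeightedC a b (1 - γ) y) :
    ∃ g : ℝ → ℝ, ContinuousOn g (Icc a b) ∧ ∀ x ∈ Ioc a b, y x = g x * (x - a) ^ (γ - 1) := by
  obtain ⟨g, hg, hgy⟩ := hy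
  refine ⟨g, hg, fun x hx => ?_⟩
  have hxa : 0 < x - a := sub_pos.2 hx.1
  rw [hgy x hx, mul_right_comm, ← Real.rpow_add hxa, sub_add_sub_cancel', sub_self, Real.rpow_zero,
    one_mul]

lemma MemWeightedC.continuousOn (hy : MemWeightedC a b (1 - γ) y) : ContinuousOn y (Ioc a b) := by
  obtain ⟨g, hg, hgy⟩ := hy.exists_eq
  exact ((hg.mono Ioc_subset_Icc_self).mul (continuousOn_sub_rpow a b _)).congr hgy

lemma MemWeightedC.exists_abs_indicator_le (hγ : 0 < γ) (hy : MemWeightedC a b (1 - γ) y) :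
    ∃ M, ∀ x, |(Ioc a b).indicator y x| ≤ M * rlKernel γ (x - a) := by
  obtain ⟨g, hg, hgy⟩ := hy.exists_eq
  obtain ⟨C, hC⟩ := isCompact_Icc.exists_bound_of_continuousOn hg
  have hΓ := Real.Gamma_pos_of_pos hγ
  refine ⟨|C| * Real.Gamma γ, fun x => ?_⟩
  by_cases hx : x ∈ Ioc a b
  · have hxa : 0 < x - a := sub_pos.2 hx.1
    rw [indicator_of_mem hx, hgy x hx, rlKernel_of_pos hxa, abs_mul,
      abs_of_pos (Real.rpow_pos_of_pos hxa _), mul_assoc, mul_div_cancel₀ _ hΓ.ne']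
    exact mul_le_mul_of_nonneg_right ((hC x (Ioc_subset_Icc_self hx)).trans (le_abs_self C))
      (Real.rpow_nonneg hxa.le _)
  · rw [indicator_of_notMem hx, abs_zero]
    exact mul_nonneg (by positivity) (rlKernel_nonneg hγ.le _)

lemma MemWeightedC.rlIntegrableAt_indicator (hγ : 0 < γ) (hs : 0 < s)
    (hy : MemWeightedC a b (1 - γ) y) (x : ℝ) : RLIntegrableAt s ((Ioc a b).indicator y) x := by
  obtain ⟨M, hM⟩ := hy.exists_abs_indicator_le hγ
  have hker : Measurable fun τ => rlKernel s (x - τ) := by fun_prop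
  have hym : AEStronglyMeasurable ((Ioc a b).indicator y) :=
    (aestronglyMeasurable_indicator_iff measurableSet_Ioc).2
      (hy.continuousOn.aestronglyMeasurable measurableSet_Ioc)
  refine ((rlIntegrableAt_rlKernel hs hγ a x).const_mul M).mono'
    (hker.aestronglyMeasurable.mul hym) (ae_of_all _ fun τ => ?_)
  rw [norm_mul, Real.norm_of_nonneg (rlKernel_nonneg hs.le _)]
  exact mul_le_mul_of_nonneg_left (hM τ) (rlKernel_nonneg hs.le _)

lemma MemWeightedC.integrableOn (hγ : 0 < γ) (hy : MemWeightedC a b (1 - γ) y) :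
    IntegrableOn y (Ioc a b) := by
  have hone := rlIntegrableAt_one_iff.1 (hy.rlIntegrableAt_indicator hγ one_pos b)
  rw [IntegrableOn, integrable_indicator_iff measurableSet_Ioc] at hone
  rwa [IntegrableOn, Measure.restrict_restrict_of_subset Ioc_subset_Iic_self] at hone

end WeightedSpace

section Volterra

variable {a b s x α β ya : ℝ} {h w y z : ℝ → ℝ} {f : ℝ → ℝ → ℝ}

lemma rlIntegrableAt_indicator_of_one_le (hs : 1 ≤ s) (hh : IntegrableOn h (Ioc a b)) (x : ℝ) :
    RLIntegrableAt s ((Ioc a b).indicator h) x := by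
  have hs0 : 0 < s := by linarith
  have := Real.Gamma_pos_of_pos hs0
  have hker : Measurable fun τ => rlKernel s (x - τ) := by fun_prop
  simp only [RLIntegrableAt, ← indicator_mul_right (Ioc a b) fun τ => rlKernel s (x - τ)]
  rw [integrable_indicator_iff measurableSet_Ioc]
  refine Integrable.bdd_mul (c := |x - a| ^ (s - 1) / Real.Gamma s) hh
    hker.aestronglyMeasurable ?_
  filter_upwards [ae_restrict_mem measurableSet_Ioc] with τ hτ
  rw [Real.norm_of_nonneg (rlKernel_nonneg hs0.le _)]
  rcases le_or_gt x τ with hx | hx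
  · rw [rlKernel_of_nonpos (sub_nonpos.2 hx)]
    positivity
  · have hle : x - τ ≤ |x - a| := le_trans (by linarith [hτ.1]) (le_abs_self _)
    rw [rlKernel_of_pos (sub_pos.2 hx)]
    gcongr

lemma rlInt_indicator_eq_fracIntegral (s : ℝ) (h : ℝ → ℝ) (hx : x ≤ b) :
    rlInt s ((Ioc a b).indicator h) x = (Ioc a b).indicator (fracIntegral a s h) x := by
  unfold rlInt fracIntegral
  split_ifs with hs
  · rfl
  have hker (τ : ℝ) : rlKernel s (x - τ) * (Ioc a b).indicator h τ =
      (Ioo a x).indicator (fun τ => 1 / Real.Gamma s * (h τ / (x - τ) ^ (1 - s))) τ := by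
    by_cases hτ : τ ∈ Ioo a x
    · have hp : 0 < x - τ := sub_pos.2 hτ.2
      rw [indicator_of_mem hτ, indicator_of_mem (show τ ∈ Ioc a b from ⟨hτ.1, hτ.2.le.trans hx⟩),
        rlKernel_of_pos hp, ← neg_sub 1 s, Real.rpow_neg hp.le]
      ring
    · rw [indicator_of_notMem hτ]
      by_cases hτa : a < τ
      · rw [rlKernel_of_nonpos (sub_nonpos.2 (not_lt.1 fun hτx => hτ ⟨hτa, hτx⟩)), zero_mul]
      · rw [indicator_of_notMem fun hm => hτa hm.1, mul_zero]
  simp only [hker]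
  rw [integral_indicator measurableSet_Ioo, integral_const_mul]
  by_cases hxa : a < x
  · rw [indicator_of_mem (show x ∈ Ioc a b from ⟨hxa, hx⟩),
      intervalIntegral.integral_of_le hxa.le, integral_Ioc_eq_integral_Ioo]
  · rw [indicator_of_notMem fun hm => hxa hm.1, Ioo_eq_empty hxa, setIntegral_empty, mul_zero]

lemma integrableOn_of_div_rpow (hs : 0 ≤ s)
    (hh : IntegrableOn (fun t => h t / (b - t) ^ s) (Ioc a b)) : IntegrableOn h (Ioc a b) := by
  have hcont : ContinuousOn (fun t => (b - t) ^ s) (Icc a b) :=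
    ContinuousOn.rpow_const (by fun_prop) fun _ _ => Or.inr hs
  rw [← integrableOn_Icc_iff_integrableOn_Ioc] at hh
  have hmul := hh.mul_continuousOn hcont isCompact_Icc
  rw [integrableOn_Icc_iff_integrableOn_Ioo] at hmul
  rw [integrableOn_Ioc_iff_integrableOn_Ioo]
  refine hmul.congr_fun (fun t ht => ?_) measurableSet_Ioo
  exact div_mul_cancel₀ _ (Real.rpow_pos_of_pos (sub_pos.2 ht.2) _).ne'

lemma MemHilferSpace.integrableOn_innerDeriv (hγ : 0 < α + β * (1 - α))
    (hβ : β * (1 - α) ≤ 1) (hy : MemHilferSpace a b α β y) :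
    IntegrableOn (innerDeriv a b α β y) (Ioc a b) := by
  rcases le_or_gt b a with hba | hab
  · rw [Ioc_eq_empty hba.not_gt]
    exact integrableOn_empty
  obtain ⟨-, hdiff, hD⟩ := hy
  by_cases h0 : β * (1 - α) = 0
  · refine (hD.integrableOn hγ).congr_fun (fun x _ => ?_) measurableSet_Ioc
    rw [hilferDeriv, fracIntegral, if_pos h0]
  · refine integrableOn_of_div_rpow (sub_nonneg.2 hβ) ?_
    rw [← intervalIntegrable_iff_integrableOn_Ioc_of_le hab.le]
    exact hdiff.outer_of_ne_zero h0 b ⟨hab, le_rfl⟩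

lemma eq_add_integral_deriv_of_tendsto {l : ℝ} (hax : a < x)
    (hac : ∀ c ∈ Ioo a x, AbsolutelyContinuousOnInterval w c x)
    (hint : IntegrableOn (deriv w) (Ioc a x)) (hl : Tendsto w (𝓝[>] a) (𝓝 l)) :
    w x = l + ∫ t in a..x, deriv w t := by
  have hprim : Tendsto (fun c => ∫ t in c..x, deriv w t) (𝓝[>] a)
      (𝓝 (∫ t in a..x, deriv w t)) := by
    have hcont := intervalIntegral.continuousOn_primitive_interval_left (μ := volume)
      (f := deriv w) (a := a) (b := x)
      (by rwa [uIcc_of_le hax.le, integrableOn_Icc_iff_integrableOn_Ioc])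
    rw [uIcc_of_le hax.le] at hcont
    exact (hcont a (left_mem_Icc.2 hax.le)).mono_left (nhdsWithin_le_iff.2
      (mem_of_superset (Ioo_mem_nhdsGT hax) Ioo_subset_Icc_self))
  have hdiff : (fun c => w x - w c) =ᶠ[𝓝[>] a] fun c => ∫ t in c..x, deriv w t := by
    filter_upwards [Ioo_mem_nhdsGT hax] with c hc using (hac c hc).integral_deriv_eq_sub.symm
  exact sub_eq_iff_eq_add'.1
    (tendsto_nhds_unique_of_eventuallyEq (tendsto_const_nhds.sub hl) hprim hdiff)

lemma eq_add_integral_derivWithin_of_tendsto {l : ℝ}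
    (hac : ∀ c ∈ Ioo a b, AbsolutelyContinuousOnInterval w c b)
    (hint : IntegrableOn (derivWithin w (Ioc a b)) (Ioc a b))
    (hl : Tendsto w (𝓝[>] a) (𝓝 l)) (hx : x ∈ Ioc a b) :
    w x = l + ∫ t in a..x, derivWithin w (Ioc a b) t := by
  have heq : EqOn (derivWithin w (Ioc a b)) (deriv w) (Ioo a x) := fun t ht =>
    derivWithin_of_mem_nhds (Ioc_mem_nhds ht.1 (ht.2.trans_le hx.2))
  rw [intervalIntegral.integral_congr_Ioo_of_le hx.1.le heq]
  refine eq_add_integral_deriv_of_tendsto hx.1 (fun c hc => ?_) ?_ hl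
  · refine (hac c ⟨hc.1, hc.2.trans_le hx.2⟩).mono ?_
    rw [uIcc_of_le hc.2.le, uIcc_of_le (hc.2.le.trans hx.2)]
    exact Icc_subset_Icc_right hx.2
  · have hint' := hint.mono_set (Ioc_subset_Ioc_right hx.2)
    rw [integrableOn_Ioc_iff_integrableOn_Ioo] at hint' ⊢
    exact hint'.congr_fun heq measurableSet_Ioo

lemma HilferDifferentiable.rlInt_indicator_eq (hy : HilferDifferentiable a b α β y)
    (hint : IntegrableOn (innerDeriv a b α β y) (Ioc a b))
    (hinit : Tendsto (fracIntegral a ((1 - β) * (1 - α)) y) (𝓝[>] a) (𝓝 ya)) (hx : x ≤ b) :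
    rlInt ((1 - β) * (1 - α)) ((Ioc a b).indicator y) x =
      ya * rlKernel 1 (x - a) + rlInt 1 ((Ioc a b).indicator (innerDeriv a b α β y)) x := by
  rw [rlInt_indicator_eq_fracIntegral _ _ hx, rlInt_indicator_eq_fracIntegral _ _ hx]
  by_cases hxa : a < x
  · have hm : x ∈ Ioc a b := ⟨hxa, hx⟩
    rw [indicator_of_mem hm, indicator_of_mem hm, rlKernel_one_of_pos (sub_pos.2 hxa), mul_one,
      eq_add_integral_derivWithin_of_tendsto hy.absCont hint hinit hm]
    simp [fracIntegral, innerDeriv]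
  · rw [indicator_of_notMem fun hm => hxa hm.1, indicator_of_notMem fun hm => hxa hm.1,
      rlKernel_of_nonpos (sub_nonpos.2 (not_lt.1 hxa)), mul_zero, add_zero]

lemma IsCauchySolution.ae_eq_volterra (hα0 : 0 < α) (hα1 : α ≤ 1) (hβ0 : 0 ≤ β)
    (hβ1 : β ≤ 1) (hy : IsCauchySolution a b α β f ya y) :
    ∀ᵐ x, x ∈ Ioo a b → y x = ya * rlKernel (α + β * (1 - α)) (x - a) +
      rlInt α ((Ioc a b).indicator fun t => f t (y t)) x := by
  have hinner : 0 ≤ (1 - β) * (1 - α) := mul_nonneg (sub_nonneg.2 hβ1) (sub_nonneg.2 hα1)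
  have houter : 0 ≤ β * (1 - α) := mul_nonneg hβ0 (sub_nonneg.2 hα1)
  have hγ : 0 < α + β * (1 - α) := by linarith
  have hsum : α + β * (1 - α) + (1 - β) * (1 - α) = 1 := by ring
  have hYi := hy.mem.1.integrableOn hγ
  have hVi := hy.mem.integrableOn_innerDeriv hγ (by linarith)
  have hVm := ((integrable_indicator_iff measurableSet_Ioc).2 hVi).aestronglyMeasurable
  have hV1 := rlIntegrableAt_indicator_of_one_le (le_add_of_nonneg_right hγ.le) hVi
  have hinit := hy.initial
  rw [← eq_sub_of_add_eq' hsum] at hinit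
  have habel := ae_eq_of_rlInt_eq a hinner hγ hsum
    ((integrable_indicator_iff measurableSet_Ioc).2 hYi).aestronglyMeasurable
    (fun x _ => rlIntegrableAt_indicator_of_one_le le_rfl hYi x) hVm (fun x _ => hV1 x)
    fun x hx => hy.mem.2.1.rlInt_indicator_eq hVi hinit hx
  filter_upwards [habel, (hV1 b).ae_of_one_add hγ hVm] with x hx hVx hxab
  rw [← indicator_of_mem (Ioo_subset_Ioc_self hxab) y, hx hxab.2,
    ← rlInt_rlInt hα0.le houter hVm (hVx hxab.2)]
  congr 1
  refine rlInt_congr fun τ hτ => ?_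
  rw [rlInt_indicator_eq_fracIntegral _ _ (hτ.trans hxab.2.le)]
  exact congrFun (indicator_congr hy.equation) τ

lemma IsCauchySolution.ae_abs_sub_le {za A : ℝ} (hα0 : 0 < α) (hα1 : α ≤ 1)
    (hβ0 : 0 ≤ β) (hβ1 : β ≤ 1)
    (hLip : ∀ x ∈ Ioc a b, ∀ y₁ y₂ : ℝ, |f x y₁ - f x y₂| ≤ A * |y₁ - y₂|)
    (hy : IsCauchySolution a b α β f ya y) (hz : IsCauchySolution a b α β f za z) :
    ∀ᵐ x, x ∈ Ioo a b → |y x - z x| ≤ |ya - za| * rlKernel (α + β * (1 - α)) (x - a) +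
      A * rlInt α ((Ioc a b).indicator fun t => |y t - z t|) x := by
  have hγ : 0 < α + β * (1 - α) := by linarith [mul_nonneg hβ0 (sub_nonneg.2 hα1)]
  filter_upwards [hy.ae_eq_volterra hα0 hα1 hβ0 hβ1, hz.ae_eq_volterra hα0 hα1 hβ0 hβ1]
    with x hyx hzx hx
  have hfy := (hy.mem.2.2.congr hy.equation).rlIntegrableAt_indicator hγ hα0 x
  have hfz := (hz.mem.2.2.congr hz.equation).rlIntegrableAt_indicator hγ hα0 x
  have hu := (hy.mem.1.sub hz.mem.1).abs.rlIntegrableAt_indicator hγ hα0 x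
  set F := (Ioc a b).indicator fun t => f t (y t) with hF
  set G := (Ioc a b).indicator fun t => f t (z t) with hG
  have hFG (τ : ℝ) : |F τ - G τ| ≤ A * (Ioc a b).indicator (fun t => |y t - z t|) τ := by
    by_cases hτ : τ ∈ Ioc a b
    · simpa only [hF, hG, indicator_of_mem hτ] using hLip τ hτ (y τ) (z τ)
    · simp [hF, hG, indicator_of_notMem hτ]
  calc |y x - z x|
      = |(ya - za) * rlKernel (α + β * (1 - α)) (x - a) + rlInt α (fun τ => F τ - G τ) x| := by
        rw [hyx hx, hzx hx, rlInt_sub hα0 hfy hfz]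
        ring_nf
    _ ≤ |ya - za| * rlKernel (α + β * (1 - α)) (x - a) + |rlInt α (fun τ => F τ - G τ) x| := by
        refine (abs_add_le _ _).trans_eq ?_
        rw [abs_mul, abs_of_nonneg (rlKernel_nonneg hγ.le _)]
    _ ≤ _ := by
        gcongr
        rw [← rlInt_const_mul hα0]
        exact abs_rlInt_le hα0 (hu.const_mul A) hFG

lemma IsCauchySolution.ae_indicator_abs_sub_le {za A : ℝ} (hα0 : 0 < α)
    (hα1 : α ≤ 1) (hβ0 : 0 ≤ β) (hβ1 : β ≤ 1) (hA : 0 ≤ A)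
    (hLip : ∀ x ∈ Ioc a b, ∀ y₁ y₂ : ℝ, |f x y₁ - f x y₂| ≤ A * |y₁ - y₂|)
    (hy : IsCauchySolution a b α β f ya y) (hz : IsCauchySolution a b α β f za z) :
    ∀ᵐ x, (Ioc a b).indicator (fun t => |y t - z t|) x ≤
      |ya - za| * rlKernel (α + β * (1 - α)) (x - a) +
        A * rlInt α ((Ioc a b).indicator fun t => |y t - z t|) x := by
  have hγ : 0 ≤ α + β * (1 - α) := by linarith [mul_nonneg hβ0 (sub_nonneg.2 hα1)]
  filter_upwards [hy.ae_abs_sub_le hα0 hα1 hβ0 hβ1 hLip hz, Measure.ae_ne volume b]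
    with x hx hxb
  by_cases hxm : x ∈ Ioc a b
  · rw [indicator_of_mem hxm]
    exact hx ⟨hxm.1, hxm.2.lt_of_ne hxb⟩
  · rw [indicator_of_notMem hxm]
    exact add_nonneg (mul_nonneg (abs_nonneg _) (rlKernel_nonneg hγ _))
      (mul_nonneg hA (rlInt_nonneg hα0 (indicator_nonneg fun _ _ => abs_nonneg _)))

end Volterra

lemma le_on_of_ae_restrict_le {X Y : Type*} [TopologicalSpace X] [MeasurableSpace X]
    {μ : Measure X} [μ.IsOpenPosMeasure] [LinearOrder Y] [TopologicalSpace Y]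
    [OrderClosedTopology Y] {S : Set X} (hS : S ⊆ closure (interior S)) {f g : X → Y}
    (hf : ContinuousOn f S) (hg : ContinuousOn g S) (h : f ≤ᵐ[μ.restrict S] g) :
    ∀ x ∈ S, f x ≤ g x := by
  have heq : EqOn (fun x => max (f x) (g x)) g S :=
    Measure.eqOn_of_ae_eq (h.mono fun x hx => max_eq_right hx) (hf.sup hg) hg hS
  exact fun x hx => max_eq_right_iff.1 (heq hx)

theorem theorem4p2_general (a b α β γ A : ℝ) (hα0 : 0 < α) (hα1 : α ≤ 1) (hβ0 : 0 ≤ β)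
    (hβ1 : β ≤ 1) (hγ : γ = α + β - α * β) (f : ℝ → ℝ → ℝ)
    (hLip : ∀ x ∈ Ioc a b, ∀ y₁ y₂ : ℝ, |f x y₁ - f x y₂| ≤ A * |y₁ - y₂|)
    (ya ε : ℝ) (y yhat : ℝ → ℝ)
    (hy : IsCauchySolution a b α β f ya y)
    (hyhat : IsCauchySolution a b α β f (ya + ε) yhat) :
    ∀ x ∈ Ioc a b,
      |y x - yhat x| ≤
        |ε| * (x - a) ^ (γ - 1) * mittagLeffler α γ (A * (x - a) ^ α) := by
  intro x₀ hx₀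
  obtain rfl : γ = α + β * (1 - α) := by rw [hγ]; ring
  have hγ0 : 0 < α + β * (1 - α) := by linarith [mul_nonneg hβ0 (sub_nonneg.2 hα1)]
  have hA : 0 ≤ A := by simpa using (abs_nonneg _).trans (hLip x₀ hx₀ 0 1)
  have hu := (hy.mem.1.sub hyhat.mem.1).abs
  obtain ⟨M, hM⟩ := hu.exists_abs_indicator_le hγ0
  have hstep := hy.ae_indicator_abs_sub_le hα0 hα1 hβ0 hβ1 hA hLip hyhat
  rw [sub_add_cancel_left, abs_neg] at hstep
  have hbound := ae_le_mittagLeffler_of_ae_le_rlInt hα0 hγ0 hA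
    (indicator_nonneg fun _ _ => abs_nonneg _)
    (ae_of_all _ fun x => (le_abs_self _).trans (hM x)) hstep
  refine le_on_of_ae_restrict_le (μ := volume) (Ioc_subset_closure_interior a b) hu.continuousOn
    (continuousOn_rpow_mul_mittagLeffler hα0 a b _ _ A) ?_ x₀ hx₀
  rw [EventuallyLE, ae_restrict_iff' measurableSet_Ioc]
  filter_upwards [hbound] with x hx hxm
  simpa only [indicator_of_mem hxm] using hx hxm.1

theorem theorem4p2 (a b α β γ A : ℝ) (hab : a < b)
    (hα0 : 0 < α) (hα1 : α < 1) (hβ0 : 0 ≤ β) (hβ1 : β ≤ 1) (hγ : γ = α + β - α * β)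
    (f : ℝ → ℝ → ℝ)
    (hf : ∀ y : ℝ → ℝ, MemWeightedC a b (1 - γ) y →
      MemWeightedC a b (1 - γ) (fun x => f x (y x)))
    (hA : 0 < A)
    (hLip : ∀ x ∈ Ioc a b, ∀ y₁ y₂ : ℝ, |f x y₁ - f x y₂| ≤ A * |y₁ - y₂|)
    (ya ε : ℝ) (y yhat : ℝ → ℝ)
    (hy : IsCauchySolution a b α β f ya y)
    (hyhat : IsCauchySolution a b α β f (ya + ε) yhat) :
    ∀ x ∈ Ioc a b,
      |y x - yhat x| ≤
        |ε| * (x - a) ^ (γ - 1) * mittagLeffler α γ (A * (x - a) ^ α) :=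
  theorem4p2_general a b α β γ A hα0 hα1.le hβ0 hβ1 hγ f hLip ya ε y yhat hy hyhat
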